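/- **Notation.** For $k\in\mathbb N$ let $\mathcal F_k$ be the set of functions $f:\mathbb F_2^k\to\{1,-1\}$. For $\alpha\in\mathbb F_2^k$ let $\chi_\alpha\in\mathcal F_k$, $\chi_\alpha(x)=(-1)^{\sum_i\alpha_ix_i}$. The functions $\pm\chi_\alpha$ are called affine. For $f\in\mathcal F_k$ let $\hat f_\alpha=2^{-k}\sum_x\chi_\alpha(x)f(x)$, let $\mathrm{affine}(f)\subseteq\mathbb F_2^k$ be the affine span over $\mathbb F_2$ of $\{\alpha:\hat f_\alpha\ne0\}$, and let $\dim(f)$ be its dimension. $\mathbb E$ denotes the average over a finite set. **Gadgets.** A $\mathrm{Had}_k$-to-2Lin(2) gadget is a probability distribution $G$ on the unordered pairs $\{f_1,f_2\}$ of distinct elements of $\mathcal F_k$ with $G(f,-f)=0$ for all $f$; put $G(f,f)=0$. For $A:\mathcal F_k\to\mathbb F_2$ let $\mathrm{val}(A,G)=\sum_{\{f_1,f_2\}}G(f_1,f_2)\,[A(f_1)=A(f_2)]$. * *Completeness:* $c(G)=\mathbb E_{y\in\mathbb F_2^k}\mathrm{val}(\delta_y,G)$, where $(-1)^{\delta_y(f)}=f(y)$.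 * *Relaxed soundness:* $rs(G)=\mathbb E_P\max_A\mathrm{val}(A,G)$, where $P$ ranges over all maps from the set of affine functions in $\mathcal F_k$ to $\mathbb F_2$ with $P(-f)=1+P(f)$ for all $f$, and $A$ ranges over all maps $\mathcal F_k\to\mathbb F_2$ extending $P$. * *Infinity relaxed soundness:* for $w:\mathcal F_k^3\to\mathbb R_{\ge0}$ put $\mathrm{out}_w(f,g)=\sum_{f_2}w(f,f_2,g)$, $\mathrm{in}_w(f,g)=\sum_{f_2}w(f_2,f,g)$ and $\mathrm{val}_g(w)=\sum_{\alpha\in\mathbb F_2^k}\big(\mathrm{out}_w(g(\alpha)\chi_\alpha,g)-\mathrm{in}_w(g(\alpha)\chi_\alpha,g)\big)$. Call $w$ an infinity relaxed flow of $G$ if $w(f_1,f_2,g)+w(f_2,f_1,g)\le G(f_1,f_2)$ for all $f_1,f_2,g\in\mathcal F_k$, and for all $f,g\in\mathcal F_k$ with $\dim(f)\ge1$ one has $\sum_{g'}\mathrm{out}_w(f,g')=\sum_{g'}\mathrm{in}_w(f,g')$, the sums being over all $g'\in\mathcal F_k$ that agree with $g$ on $\mathrm{affine}(f)$. Then $rs_\infty(G)=1-\max_w\mathbb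 E_{g\in\mathcal F_k}\mathrm{val}_g(w)$, the maximum being over all infinity relaxed flows $w$ of $G$. **Full lift.** For $k\le k'$ let $\mathcal M_{k\to k'}$ be the set of all maps $M=M_{A,b,\beta,c}:\mathcal F_k\to\mathcal F_{k'}$ of the form $M(f)(y)=f(Ay+b)\,(-1)^c\chi_\beta(y)$, with $A\in\mathbb F_2^{k\times k'}$ of full rank $k$, $b\in\mathbb F_2^k$, $\beta\in\mathbb F_2^{k'}$, $c\in\mathbb F_2$. The full $k\to k'$ lift of $G$ is $$\mathrm{lift}_{k\to k'}(G)(f_1',f_2')=\frac1{|\mathcal M_{k\to k'}|}\sum_{M\in\mathcal M_{k\to k'}}\ \sum_{f_1\in M^{-1}(f_1'),\,f_2\in M^{-1}(f_2')}G(f_1,f_2).$$ **Lemma.** Let $G$ be a $\mathrm{Had}_k$-to-2Lin(2) gadget and let $\varepsilon>0$. Then there is an integer $k'>k$ such that $G'=\mathrm{lift}_{k\to k'}(G)$ is a $\mathrm{Had}_{k'}$-to-2Lin(2) gadget with $c(G')=c(G)$ and $rs(G')\le rs_\infty(G)+\varepsilon$. -/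

import Mathlib

open scoped BigOperators

noncomputable section

/-- The vector space `𝔽₂^k`. -/
abbrev BoolVec (k : ℕ) : Type := Fin k → ZMod 2

/-- `k`-bit Boolean functions `𝔽₂^k → {1, -1}`; the type `ℤˣ` is exactly `{1, -1}`. -/
abbrev BoolFun (k : ℕ) : Type := BoolVec k → ℤˣ

namespace BoolFun

variable {k : ℕ}

/-- The linear Boolean function `χ_α (x) = (-1)^(α, x)`. -/
def chi (α : BoolVec k) : BoolFun k := fun x => (-1 : ℤˣ) ^ (α ⬝ᵥ x)

/-- The value `f x`, as a real number. -/
def toReal (f : BoolFun k) (x : BoolVec k) : ℝ := ((f x : ℤ) : ℝ)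

/-- The Fourier coefficient of `f` at `α`. -/
def fourier (f : BoolFun k) (α : BoolVec k) : ℝ :=
  (1 / 2 ^ k) * ∑ x : BoolVec k, (chi α).toReal x * f.toReal x

/-- The supporting affine subspace of `f`: the affine span of its Fourier support. -/
def support (f : BoolFun k) : AffineSubspace (ZMod 2) (BoolVec k) :=
  affineSpan (ZMod 2) {α : BoolVec k | f.fourier α ≠ 0}

/-- The dimension of `f` is the dimension of its supporting affine subspace. -/
def dim (f : BoolFun k) : ℕ := Module.finrank (ZMod 2) f.support.direction

/-- The functions `χ_α` and `-χ_α`, `α ∈ 𝔽₂^k` (including the constants `1` and `-1`). -/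
def IsAffine (f : BoolFun k) : Prop := ∃ α : BoolVec k, f = chi α ∨ f = -chi α

theorem IsAffine.neg {f : BoolFun k} (h : f.IsAffine) : (-f).IsAffine := by
  obtain ⟨α, rfl | rfl⟩ := h
  · exact ⟨α, Or.inr rfl⟩
  · exact ⟨α, Or.inl (neg_neg _)⟩

end BoolFun

/-- A `Had_k`-to-`2Lin(2)` gadget: a probability distribution on the unordered pairs of distinct
`k`-bit Boolean functions that gives no mass to the pairs `{f, -f}`. The mass `G(f₁, f₂)` of the
pair `{f₁, f₂}` is recorded as a symmetric function which vanishes on the diagonal, so that the sum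
over all unordered pairs is one half of the sum over all ordered ones. The variables of the gadget
are indexed by `BoolFun k`. -/
structure HadGadget (k : ℕ) where
  weight : BoolFun k → BoolFun k → ℝ
  nonneg : ∀ f₁ f₂, 0 ≤ weight f₁ f₂
  symm : ∀ f₁ f₂, weight f₁ f₂ = weight f₂ f₁
  diag : ∀ f, weight f f = 0
  antipodal : ∀ f, weight f (-f) = 0
  total : (1 / 2) * ∑ f₁, ∑ f₂, weight f₁ f₂ = 1

namespace HadGadget

variable {k : ℕ}

/-- The value `val(A, G)` of an assignment `A` of the variables `x_f`, i.e. the `G`-probability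
that a random pair satisfies `A (x_{f₁}) = A (x_{f₂})`. -/
def val (A : BoolFun k → ZMod 2) (G : HadGadget k) : ℝ :=
  (1 / 2) * ∑ f₁, ∑ f₂, G.weight f₁ f₂ * (if A f₁ = A f₂ then 1 else 0)

/-- The dictator cut of `y`: the assignment with `(-1) ^ (dictator y f) = f y`. -/
def dictator (y : BoolVec k) (f : BoolFun k) : ZMod 2 := if f y = 1 then 0 else 1

/-- The completeness `c(G)`: the expected value of a uniformly random dictator cut. -/
def completeness (G : HadGadget k) : ℝ := 𝔼 y : BoolVec k, val (dictator y) G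

/-- The folded assignments `P` of the variables in `𝕏_k ∪ {x_1, x_{-1}}`, i.e. of the variables
indexed by the functions `± χ_α`: those with `P (x_{-f}) = 1 + P (x_f)`. -/
abbrev FoldedPrimary (k : ℕ) : Type :=
  {P : {f : BoolFun k // f.IsAffine} → ZMod 2 // ∀ f, P ⟨-f.1, f.2.neg⟩ = 1 + P f}

open Classical in
/-- Wiman's relaxed soundness `rs(G)`. The supremum is over a nonempty finite set: all assignments
of all variables (not necessarily folded) that extend `P`. -/
def relaxedSoundness (G : HadGadget k) : ℝ :=
  𝔼 P : FoldedPrimary k,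
    ⨆ A : {A : BoolFun k → ZMod 2 // ∀ f : {f : BoolFun k // f.IsAffine}, A f.1 = P.1 f},
      val A.1 G

/-! ### Infinity relaxed soundness -/

/-- Flow out of `f` under the placement `g`, for a flow `w`. -/
def outflow (w : BoolFun k → BoolFun k → BoolFun k → ℝ) (f g : BoolFun k) : ℝ := ∑ f₂, w f f₂ g

/-- Flow into `f` under the placement `g`, for a flow `w`. -/
def inflow (w : BoolFun k → BoolFun k → BoolFun k → ℝ) (f g : BoolFun k) : ℝ := ∑ f₂, w f₂ f g

/-- `val_g(w) = ∑_α out_w(g(α) χ_α, g) - in_w(g(α) χ_α, g)`. -/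
def flowVal (w : BoolFun k → BoolFun k → BoolFun k → ℝ) (g : BoolFun k) : ℝ :=
  ∑ α : BoolVec k, (outflow w (fun x => g α * BoolFun.chi α x) g -
    inflow w (fun x => g α * BoolFun.chi α x) g)

open Classical in
/-- Infinity relaxed flows of `G`: nonnegative functions `w (f₁, f₂, g)` which respect the
capacities and, at every non-affine `f`, conserve flow on average over all placements `g'` that
agree with a given placement `g` on the supporting affine subspace of `f`. -/
structure IsInfRelaxedFlow (G : HadGadget k)
    (w : BoolFun k → BoolFun k → BoolFun k → ℝ) : Prop where
  nonneg : ∀ f₁ f₂ g, 0 ≤ w f₁ f₂ g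
  capacity : ∀ f₁ f₂ g, w f₁ f₂ g + w f₂ f₁ g ≤ G.weight f₁ f₂
  conservation : ∀ g f : BoolFun k, 1 ≤ f.dim →
    ∑ g' : BoolFun k with ∀ α ∈ f.support, g' α = g α, outflow w f g' =
      ∑ g' : BoolFun k with ∀ α ∈ f.support, g' α = g α, inflow w f g'

/-- The infinity relaxed soundness `rs_∞(G)`. The set of values is nonempty (zero flow), bounded
and closed, so that its supremum is the maximum of a linear program. -/
def infRelaxedSoundness (G : HadGadget k) : ℝ :=
  1 - sSup {v : ℝ | ∃ w, IsInfRelaxedFlow G w ∧ v = 𝔼 g : BoolFun k, flowVal w g}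

/-! ### Affine maps and the full lift -/

/-- `M_{A, b, β, c} (f) (y) = f (A y + b) (-1)^c χ_β (y)`. -/
def affineMap {k' : ℕ} (A : Matrix (Fin k) (Fin k') (ZMod 2)) (b : BoolVec k) (β : BoolVec k')
    (c : ZMod 2) (f : BoolFun k) : BoolFun k' :=
  fun y => f (A.mulVec y + b) * (-1 : ℤˣ) ^ c * BoolFun.chi β y

open Classical in
/-- The set of all maps `M_{A, b, β, c}` with `A` a `k × k'` matrix of full rank (`k ≤ k'`). -/
def affineMaps (k k' : ℕ) : Finset (BoolFun k → BoolFun k') :=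
  Finset.univ.filter fun M => ∃ (A : Matrix (Fin k) (Fin k') (ZMod 2)) (b : BoolVec k)
    (β : BoolVec k') (c : ZMod 2), A.rank = k ∧ M = affineMap A b β c

/-- The `M`-lift of the weights of `G`. -/
def liftWeight {k' : ℕ} (M : BoolFun k → BoolFun k') (G : HadGadget k) (f₁' f₂' : BoolFun k') : ℝ :=
  ∑ f₁ with M f₁ = f₁', ∑ f₂ with M f₂ = f₂', G.weight f₁ f₂

/-- The full `k → k'` lift of `G`: the average of the `M`-lifts over all affine maps `M`. -/
def fullLiftWeight (k' : ℕ) (G : HadGadget k) (f₁' f₂' : BoolFun k') : ℝ :=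
  𝔼 M ∈ affineMaps k k', liftWeight M G f₁' f₂'

end HadGadget

end

/-!
Identify a folded assignment `P` of the affine functions with the placement `g`, `g(α) χ_α` being
the affine function at which `P` vanishes. An affine map `M` pulls a placement of `k'`-bit functions
back to one of `k`-bit functions (`BoolFun.pull`), and an infinity relaxed flow `w` of `G` lifts to
the average over `M` of the images of `w(·, ·, pull M g)`. By the easy half of max-flow min-cut, one
minus the value of an assignment extending `P` is at least the value of this lifted flow minus its
total failure of conservation at the functions that are not affine
(`HadGadget.flowVal_sub_imbalance_le`). On average over `g` the value of the lifted flow is exactly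
that of `w`, because pullbacks of a uniform placement are uniform (`HadGadget.expect_expect_pull`).
So it remains to see that conservation fails by little when `k'` is large.

Fix `f` of dimension at least `1`. The affine permutations act transitively on the affine maps, so
the average over `M` can be replaced by an average over compositions with any one fixed map
(`BoolFun.expect_affineMaps`), and hence by an average over compositions with `m` fixed maps
`J i`. These are chosen such that all `J i f` coincide, while the placements `pull (J i) g` for
different `i` share only the values on the supporting affine subspace of `f`
(`BoolFun.exists_affineMaps_family`). Conservation of `w` says that the net flow out of `f` averages
to zero once the placement is fixed on that subspace, so the `m` net flows are pairwise uncorrelated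
for uniform `g` (`sum_mul_comp_eq_zero`), and their average is `O(1 / √m)` in mean
(`HadGadget.expect_imbalance_le`).

Completeness is preserved because a surjective affine map sends a uniform point to a uniform point.
-/

noncomputable section

namespace BoolFun

variable {k k' : ℕ}

/-! ### Affine functions and characters -/

lemma mul_self_apply (f : BoolFun k) (x : BoolVec k) : f x * f x = 1 := Int.units_mul_self _

lemma chi_add (α x y : BoolVec k) : chi α (x + y) = chi α x * chi α y := by
  simp [chi, dotProduct_add, uzpow_add]

lemma chi_add_left (α β x : BoolVec k) : chi (α + β) x = chi α x * chi β x := by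
  simp [chi, add_dotProduct, uzpow_add]

@[simp] lemma chi_zero_right (α : BoolVec k) : chi α 0 = 1 := by simp [chi]

@[simp] lemma chi_zero_left (x : BoolVec k) : chi 0 x = 1 := by simp [chi]

lemma eq_zero_or_eq_one (z : ZMod 2) : z = 0 ∨ z = 1 := by
  revert z
  decide

lemma sub_eq_add (x y : BoolVec k) : x - y = x + y := by
  funext j
  exact CharTwo.sub_eq_add _ _

lemma neg_one_uzpow_eq_one_iff (z : ZMod 2) : (-1 : ℤˣ) ^ z = 1 ↔ z = 0 := by
  obtain rfl | rfl := eq_zero_or_eq_one z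
  · simp
  · rw [uzpow_one]
    decide

lemma chi_eq_one_iff {α x : BoolVec k} : chi α x = 1 ↔ α ⬝ᵥ x = 0 :=
  neg_one_uzpow_eq_one_iff _

/-- The frequency `α` of an affine function `± χ_α`, read off from its values at the origin and at
the coordinate vectors. The value at a function that is not affine is irrelevant. -/
def freq (a : BoolFun k) : BoolVec k := fun j => if a (Pi.single j 1) = a 0 then 0 else 1

@[simp] lemma freq_smul (s : ℤˣ) (a : BoolFun k) : freq (s • a) = freq a := by
  funext j
  simp [freq]

@[simp] lemma freq_chi (α : BoolVec k) : freq (chi α) = α := by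
  funext j
  have h : chi α (Pi.single j 1) = 1 ↔ α j = 0 := by
    rw [chi_eq_one_iff, dotProduct_single, mul_one]
  simp only [freq, chi_zero_right, h]
  obtain h0 | h0 := eq_zero_or_eq_one (α j) <;> simp [h0]

lemma chi_injective : Function.Injective (chi : BoolVec k → BoolFun k) := fun α β h => by
  rw [← freq_chi α, h, freq_chi]

lemma isAffine_smul_chi (s : ℤˣ) (α : BoolVec k) : (s • chi α).IsAffine := by
  rcases Int.units_eq_one_or s with rfl | rfl
  · exact ⟨α, Or.inl (by simp)⟩
  · exact ⟨α, Or.inr (by funext x; simp)⟩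

lemma isAffine_chi (α : BoolVec k) : (chi α).IsAffine := ⟨α, Or.inl rfl⟩

lemma IsAffine.exists_eq {a : BoolFun k} (h : a.IsAffine) : ∃ s : ℤˣ, ∃ α, a = s • chi α := by
  obtain ⟨α, rfl | rfl⟩ := h
  · exact ⟨1, α, by simp⟩
  · exact ⟨-1, α, by funext x; simp⟩

lemma IsAffine.eq_smul_chi {a : BoolFun k} (h : a.IsAffine) : a = a 0 • chi (freq a) := by
  obtain ⟨s, α, rfl⟩ := h.exists_eq
  simp

lemma isAffine_iff_mul {a : BoolFun k} :
    a.IsAffine ↔ ∀ x y, a (x + y) * a 0 = a x * a y := by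
  constructor
  · intro h x y
    obtain ⟨s, α, rfl⟩ := h.exists_eq
    simp only [Pi.smul_apply, smul_eq_mul, chi_add, chi_zero_right]
    ac_rfl
  · intro h
    -- After normalisation at the origin, `a` is a homomorphism, so it is determined by its values
    -- at the coordinate vectors, where it agrees with the character of frequency `freq a`.
    let u : BoolVec k →+ Additive ℤˣ := AddMonoidHom.mk' (fun x => Additive.ofMul (a 0 * a x))
      fun x y => by
        rw [← ofMul_mul]
        congr 1
        calc a 0 * a (x + y) = a 0 * a 0 * (a (x + y) * a 0) := by
              rw [mul_self_apply, one_mul, mul_comm]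
          _ = _ := by rw [h]; ac_rfl
    let v : BoolVec k →+ Additive ℤˣ :=
      AddMonoidHom.mk' (fun x => Additive.ofMul (chi (freq a) x)) fun x y => by
        rw [← ofMul_mul, chi_add]
    have huv : u = v := by
      refine AddMonoidHom.functions_ext _ _ _ fun j z => ?_
      obtain rfl | rfl := eq_zero_or_eq_one z
      · simp
      · change Additive.ofMul (a 0 * a (Pi.single j 1)) = Additive.ofMul (chi (freq a) _)
        congr 1
        simp only [chi, dotProduct_single, mul_one, freq]
        split_ifs with h1
        · simp [h1]
        · rw [uzpow_one]
          have := Int.units_ne_iff_eq_neg.1 h1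
          rw [this, mul_neg, mul_self_apply]
    have key : a = a 0 • chi (freq a) := by
      funext x
      have hx : a 0 * a x = chi (freq a) x :=
        congrArg Additive.toMul (DFunLike.congr_fun huv x)
      simp [← hx, ← mul_assoc]
    rw [key]
    exact isAffine_smul_chi _ _

lemma IsAffine.mul {a b : BoolFun k} (ha : a.IsAffine) (hb : b.IsAffine) :
    IsAffine (fun x => a x * b x) := by
  rw [isAffine_iff_mul] at *
  intro x y
  calc a (x + y) * b (x + y) * (a 0 * b 0) = (a (x + y) * a 0) * (b (x + y) * b 0) := by ac_rfl
    _ = _ := by rw [ha, hb]; ac_rfl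

lemma IsAffine.comp_affineMap {a : BoolFun k} (ha : a.IsAffine)
    (L : BoolVec k' →ᵃ[ZMod 2] BoolVec k) : IsAffine (fun y => a (L y)) := by
  rw [isAffine_iff_mul] at *
  have hL : ∀ y, L y = L.linear y + L 0 := fun y => congrFun L.decomp y
  have h0 : ∀ y, a (L y) = a (L.linear y) * a (L 0) * a 0 := fun y => by
    rw [hL y, ← ha (L.linear y) (L 0), mul_assoc, mul_self_apply, mul_one]
  intro x y
  rw [h0 (x + y), h0 x, h0 y, map_add]
  have := ha (L.linear x) (L.linear y)
  calc _ = (a (L.linear x + L.linear y) * a 0) * (a (L 0) * a (L 0)) := by ac_rfl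
    _ = a (L.linear x) * a (L.linear y) * (a (L 0) * a (L 0)) * (a 0 * a 0) := by
        rw [this, mul_self_apply a 0, mul_one]
    _ = _ := by ac_rfl

/-- The sign of the affine function `a = s χ_α` under the placement `g`, i.e. `s g(α)`. It is `1`
exactly when `a` is one of the sources `g(α) χ_α`. -/
def sgn (g a : BoolFun k) : ℤˣ := a 0 * g (freq a)

@[simp] lemma sgn_smul (g : BoolFun k) (s : ℤˣ) (a : BoolFun k) : sgn g (s • a) = s * sgn g a := by
  simp [sgn, mul_assoc]

@[simp] lemma sgn_chi (g : BoolFun k) (α : BoolVec k) : sgn g (chi α) = g α := by simp [sgn]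

/-! ### Fourier inversion and the supporting affine subspace -/

lemma sum_chi_toReal (z : BoolVec k) :
    ∑ α : BoolVec k, (chi α).toReal z = if z = 0 then 2 ^ k else 0 := by
  split_ifs with h
  · subst h
    simp [toReal, ZMod.card]
  · obtain ⟨j, hj⟩ := Function.ne_iff.1 h
    have hj1 : chi (Pi.single j 1) z = -1 := by
      refine (Int.units_eq_one_or _).resolve_left fun h1 => hj ?_
      rw [chi_eq_one_iff, single_one_dotProduct] at h1
      simpa using h1
    have hs : ∑ α : BoolVec k, (chi α).toReal z = ∑ α : BoolVec k, -(chi α).toReal z := by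
      refine Fintype.sum_equiv (Equiv.addRight (Pi.single j 1)) _ _ fun α => ?_
      simp [toReal, chi_add_left, hj1]
    rw [Finset.sum_neg_distrib] at hs
    linarith

lemma sum_fourier_mul_chi (f : BoolFun k) (x : BoolVec k) :
    ∑ α : BoolVec k, f.fourier α * (chi α).toReal x = f.toReal x := by
  have h : ∀ α : BoolVec k, f.fourier α * (chi α).toReal x =
      ∑ z : BoolVec k, (1 / 2 ^ k) * f.toReal z * (chi α).toReal (z + x) := fun α => by
    rw [fourier, mul_assoc, Finset.sum_mul, Finset.mul_sum]
    refine Finset.sum_congr rfl fun z _ => ?_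
    simp only [toReal, chi_add]
    push_cast
    ring
  have hz : ∀ z : BoolVec k, z + x = 0 ↔ z = x := fun z => by
    rw [← sub_eq_add, sub_eq_zero]
  simp_rw [h]
  rw [Finset.sum_comm]
  simp_rw [← Finset.mul_sum, sum_chi_toReal, hz]
  simp only [mul_ite, mul_zero, Finset.sum_ite_eq', Finset.mem_univ, if_true]
  field_simp

lemma exists_fourier_ne_zero (f : BoolFun k) : ∃ α, f.fourier α ≠ 0 := by
  by_contra! h
  have := sum_fourier_mul_chi f 0
  simp only [h, zero_mul, Finset.sum_const_zero, toReal] at this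
  exact (f 0).ne_zero (by exact_mod_cast this.symm)

/-- Translation by a vector orthogonal to the direction of the supporting affine subspace multiplies
`f` by the value of any character from the Fourier support. -/
lemma apply_add_of_orthogonal (f : BoolFun k) {α₀ : BoolVec k} (h₀ : f.fourier α₀ ≠ 0)
    {u : BoolVec k} (hu : ∀ δ ∈ f.support.direction, δ ⬝ᵥ u = 0) (x : BoolVec k) :
    f (x + u) = f x * chi α₀ u := by
  have key : f.toReal (x + u) = f.toReal x * (chi α₀).toReal u := by
    rw [← sum_fourier_mul_chi, ← sum_fourier_mul_chi f x, Finset.sum_mul]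
    refine Finset.sum_congr rfl fun α _ => ?_
    by_cases hα : f.fourier α = 0
    · simp [hα]
    · have h1 : chi α u = chi α₀ u := by
        have hd : α - α₀ ∈ f.support.direction :=
          AffineSubspace.vsub_mem_direction (subset_affineSpan _ _ hα) (subset_affineSpan _ _ h₀)
        have : chi (α + α₀) u = 1 := by
          rw [chi_eq_one_iff, ← sub_eq_add]
          exact hu _ hd
        rw [chi_add_left] at this
        rw [← mul_one (chi α u), ← mul_self_apply (chi α₀) u, ← mul_assoc, this, one_mul]
      simp only [toReal, chi_add, h1]
      push_cast
      ring
  simp only [toReal] at key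
  exact Units.ext (by exact_mod_cast key)

lemma one_le_dim_of_not_isAffine {f : BoolFun k} (hf : ¬ f.IsAffine) : 1 ≤ f.dim := by
  by_contra! h
  have hd : f.support.direction = ⊥ := by
    rw [← Submodule.finrank_eq_zero (R := ZMod 2)]
    exact Nat.lt_one_iff.1 h
  obtain ⟨α₀, h₀⟩ := exists_fourier_ne_zero f
  refine hf ?_
  have : f = f 0 • chi α₀ := by
    funext x
    have := apply_add_of_orthogonal f h₀ (u := x) (by simp [hd]) 0
    simpa using this
  rw [this]
  exact isAffine_smul_chi _ _

end BoolFun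

/-! ### Averaging over transitive actions -/

/-- The average over a finite orbit equals the average over the acting group. -/
lemma expect_eq_expect_smul {Γ X : Type*} [Group Γ] [Fintype Γ] [MulAction Γ X] {s : Finset X}
    (hs : ∀ γ : Γ, ∀ x ∈ s, γ • x ∈ s) (htr : ∀ x ∈ s, ∀ y ∈ s, ∃ γ : Γ, γ • x = y)
    {x₀ : X} (hx₀ : x₀ ∈ s) (F : X → ℝ) : 𝔼 x ∈ s, F x = 𝔼 γ : Γ, F (γ • x₀) := by
  have h1 : ∀ x ∈ s, 𝔼 γ : Γ, F (γ • x) = 𝔼 γ : Γ, F (γ • x₀) := fun x hx => by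
    obtain ⟨δ, rfl⟩ := htr x₀ hx₀ x hx
    exact Fintype.expect_equiv (Equiv.mulRight δ) _ _ fun γ => by simp [mul_smul]
  have h2 : ∀ γ : Γ, 𝔼 x ∈ s, F (γ • x) = 𝔼 x ∈ s, F x := fun γ =>
    Finset.expect_nbij' (γ • ·) (γ⁻¹ • ·) (hs γ) (hs γ⁻¹) (fun x _ => by simp)
      (fun x _ => by simp) (fun x _ => rfl)
  calc 𝔼 x ∈ s, F x = 𝔼 γ : Γ, 𝔼 x ∈ s, F (γ • x) := by simp_rw [h2, Fintype.expect_const]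
    _ = 𝔼 x ∈ s, 𝔼 γ : Γ, F (γ • x) := Finset.expect_comm _ _ _
    _ = 𝔼 x ∈ s, 𝔼 γ : Γ, F (γ • x₀) := Finset.expect_congr rfl h1
    _ = _ := Finset.expect_const ⟨x₀, hx₀⟩ _

/-- Two surjective linear maps between the same finite-dimensional spaces differ by an automorphism
of the source: split both of them and match their kernels. -/
lemma LinearMap.exists_linearEquiv_comp_eq {K V W : Type*} [Field K] [AddCommGroup V] [Module K V]
    [AddCommGroup W] [Module K W] [FiniteDimensional K V] {f g : V →ₗ[K] W}
    (hf : Function.Surjective f) (hg : Function.Surjective g) :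
    ∃ e : V ≃ₗ[K] V, ∀ v, f v = g (e v) := by
  obtain ⟨s, hs⟩ := f.exists_rightInverse_of_surjective (LinearMap.range_eq_top.2 hf)
  obtain ⟨t, ht⟩ := g.exists_rightInverse_of_surjective (LinearMap.range_eq_top.2 hg)
  have hs' : ∀ w, f (s w) = w := fun w => LinearMap.congr_fun hs w
  have ht' : ∀ w, g (t w) = w := fun w => LinearMap.congr_fun ht w
  have hker : Module.finrank K (LinearMap.ker f) = Module.finrank K (LinearMap.ker g) := by
    have h1 := f.finrank_range_add_finrank_ker
    have h2 := g.finrank_range_add_finrank_ker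
    rw [LinearMap.range_eq_top.2 hf] at h1
    rw [LinearMap.range_eq_top.2 hg] at h2
    omega
  let e₀ := LinearEquiv.ofFinrankEq _ _ hker
  let p : V →ₗ[K] LinearMap.ker f :=
    (LinearMap.id - s ∘ₗ f).codRestrict (LinearMap.ker f) fun v => by simp [hs']
  have hp : ∀ v, (p v : V) = v - s (f v) := fun v => rfl
  let e : V →ₗ[K] V := t ∘ₗ f + (LinearMap.ker g).subtype ∘ₗ e₀.toLinearMap ∘ₗ p
  have he : ∀ v, e v = t (f v) + e₀ (p v) := fun v => rfl
  have hge : ∀ v, g (e v) = f v := fun v => by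
    rw [he, map_add, ht', LinearMap.mem_ker.1 (e₀ (p v)).2, add_zero]
  have hinj : Function.Injective e := by
    rw [← LinearMap.ker_eq_bot, LinearMap.ker_eq_bot']
    intro v hv
    have hfv : f v = 0 := by rw [← hge, hv, map_zero]
    rw [he, hfv, map_zero, zero_add] at hv
    have hpv : p v = 0 := by simpa using hv
    have := hp v
    rw [hpv, hfv] at this
    simpa using this.symm
  exact ⟨LinearEquiv.ofInjectiveEndo e hinj, fun v => (hge v).symm⟩

namespace BoolFun

variable {k k' : ℕ}

/-! ### Affine maps between spaces of Boolean functions -/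

/-- The map `f ↦ (y ↦ f (L y) h(y))`. The maps `M_{A, b, β, c}` with `A` of full rank are those with
`L` a surjective affine map and `h` an affine function. -/
def twist (L : BoolVec k' →ᵃ[ZMod 2] BoolVec k) (h : BoolFun k') (f : BoolFun k) : BoolFun k' :=
  fun y => f (L y) * h y

lemma twist_injective {L : BoolVec k' →ᵃ[ZMod 2] BoolVec k} (hL : Function.Surjective L)
    (h : BoolFun k') : Function.Injective (twist L h) := fun f₁ f₂ hf => by
  funext x
  obtain ⟨y, rfl⟩ := hL x
  exact mul_right_cancel (congrFun hf y)

lemma twist_smul (L : BoolVec k' →ᵃ[ZMod 2] BoolVec k) (h : BoolFun k') (s : ℤˣ) (f : BoolFun k) :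
    twist L h (s • f) = s • twist L h f := by
  funext y
  simp [twist, mul_assoc]

lemma isAffine_twist (L : BoolVec k' →ᵃ[ZMod 2] BoolVec k) {h : BoolFun k'} (hh : h.IsAffine)
    {f : BoolFun k} (hf : f.IsAffine) : (twist L h f).IsAffine :=
  (hf.comp_affineMap L).mul hh

open HadGadget in
lemma mem_affineMaps_iff {M : BoolFun k → BoolFun k'} :
    M ∈ affineMaps k k' ↔ ∃ L : BoolVec k' →ᵃ[ZMod 2] BoolVec k, Function.Surjective L ∧
      ∃ h : BoolFun k', h.IsAffine ∧ M = twist L h := by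
  have hrank : ∀ A : Matrix (Fin k) (Fin k') (ZMod 2),
      A.rank = k ↔ Function.Surjective A.mulVecLin := fun A => by
    rw [← LinearMap.range_eq_top]
    constructor
    · intro h
      exact Submodule.eq_top_of_finrank_eq (by rw [← Matrix.rank, h]; simp)
    · intro h
      rw [Matrix.rank, h]
      simp
  simp only [affineMaps, Finset.mem_filter, Finset.mem_univ, true_and]
  constructor
  · rintro ⟨A, b, β, c, hA, rfl⟩
    refine ⟨A.mulVecLin.toAffineMap + AffineMap.const _ _ b, ?_, (-1 : ℤˣ) ^ c • chi β,
      isAffine_smul_chi _ _, ?_⟩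
    · intro x
      obtain ⟨y, hy⟩ := (hrank A).1 hA (x - b)
      exact ⟨y, by simpa using congrArg (· + b) hy⟩
    · funext f y
      simp [affineMap, twist, mul_assoc]
  · rintro ⟨L, hL, h, hh, rfl⟩
    have hLy : ∀ y, L y = (LinearMap.toMatrix' L.linear).mulVec y + L 0 := fun y => by
      rw [LinearMap.toMatrix'_mulVec]
      exact congrFun L.decomp y
    obtain ⟨c, hc⟩ : ∃ c : ZMod 2, (-1 : ℤˣ) ^ c = h 0 := by
      rcases Int.units_eq_one_or (h 0) with h0 | h0
      · exact ⟨0, by simp [h0]⟩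
      · exact ⟨1, by rw [h0, uzpow_one]⟩
    refine ⟨LinearMap.toMatrix' L.linear, L 0, freq h, c, ?_, ?_⟩
    · rw [hrank]
      intro x
      obtain ⟨y, hy⟩ := hL (x + L 0)
      exact ⟨y, add_right_cancel ((hLy y).symm.trans hy)⟩
    · funext f y
      simp only [affineMap, twist, hLy y]
      rw [hc, mul_assoc]
      congr 1
      conv_lhs => rw [hh.eq_smul_chi]
      rfl

open HadGadget

lemma injective_of_mem_affineMaps {M : BoolFun k → BoolFun k'} (hM : M ∈ affineMaps k k') :
    Function.Injective M := by
  obtain ⟨L, hL, h, -, rfl⟩ := mem_affineMaps_iff.1 hM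
  exact twist_injective hL h

lemma map_smul_of_mem_affineMaps {M : BoolFun k → BoolFun k'} (hM : M ∈ affineMaps k k')
    (s : ℤˣ) (f : BoolFun k) : M (s • f) = s • M f := by
  obtain ⟨L, -, h, -, rfl⟩ := mem_affineMaps_iff.1 hM
  exact twist_smul L h s f

lemma isAffine_of_mem_affineMaps {M : BoolFun k → BoolFun k'} (hM : M ∈ affineMaps k k')
    {f : BoolFun k} (hf : f.IsAffine) : (M f).IsAffine := by
  obtain ⟨L, -, h, hh, rfl⟩ := mem_affineMaps_iff.1 hM
  exact isAffine_twist L hh hf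

lemma comp_mem_affineMaps {k'' : ℕ} {N : BoolFun k' → BoolFun k''} {M : BoolFun k → BoolFun k'}
    (hN : N ∈ affineMaps k' k'') (hM : M ∈ affineMaps k k') : N ∘ M ∈ affineMaps k k'' := by
  obtain ⟨L, hL, h, hh, rfl⟩ := mem_affineMaps_iff.1 hM
  obtain ⟨L', hL', h', hh', rfl⟩ := mem_affineMaps_iff.1 hN
  refine mem_affineMaps_iff.2 ⟨L.comp L', hL.comp hL', _, (hh.comp_affineMap L').mul hh', ?_⟩
  funext f y
  simp [twist, mul_assoc]

/-- The group of bijective affine maps of `k`-bit Boolean functions. -/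
def affinePerms (k : ℕ) : Subgroup (Equiv.Perm (BoolFun k)) where
  carrier := {T | ⇑T ∈ affineMaps k k}
  mul_mem' {S T} hS hT := by
    simpa using comp_mem_affineMaps hS hT
  one_mem' := mem_affineMaps_iff.2 ⟨AffineMap.id _ _, Function.surjective_id, chi 0,
    isAffine_chi 0, by funext f y; simp [twist]⟩
  inv_mem' {T} hT := by
    obtain ⟨L, hL, h, hh, hLh⟩ := mem_affineMaps_iff.1 hT
    let e : BoolVec k ≃ᵃ[ZMod 2] BoolVec k :=
      AffineEquiv.ofBijective (φ := L) ⟨Finite.injective_iff_surjective.2 hL, hL⟩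
    have he : ∀ y, L (e.symm y) = y := fun y => e.apply_symm_apply y
    refine mem_affineMaps_iff.2 ⟨e.symm, e.symm.surjective, _,
      hh.comp_affineMap e.symm.toAffineMap, ?_⟩
    funext f
    refine T.injective ?_
    change T (T.symm f) = T _
    rw [T.apply_symm_apply, hLh]
    funext y
    have : e.symm (L y) = y := e.symm_apply_apply y
    simp [twist, this, mul_assoc]

lemma exists_affinePerms_comp_eq {M N : BoolFun k → BoolFun k'} (hM : M ∈ affineMaps k k')
    (hN : N ∈ affineMaps k k') : ∃ T : affinePerms k', ∀ f, T.1 (M f) = N f := by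
  obtain ⟨L, hL, h, hh, rfl⟩ := mem_affineMaps_iff.1 hM
  obtain ⟨L', hL', h', hh', rfl⟩ := mem_affineMaps_iff.1 hN
  have hlin : ∀ y, L y = L.linear y + L 0 := fun y => congrFun L.decomp y
  have hlin' : ∀ y, L' y = L'.linear y + L' 0 := fun y => congrFun L'.decomp y
  obtain ⟨e, he⟩ := LinearMap.exists_linearEquiv_comp_eq
    (L'.linear_surjective_iff.2 hL') (L.linear_surjective_iff.2 hL)
  obtain ⟨v, hv⟩ := L.linear_surjective_iff.2 hL (L' 0 - L 0)
  let E : BoolVec k' ≃ᵃ[ZMod 2] BoolVec k' :=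
    e.toAffineEquiv.trans (AffineEquiv.constVAdd (ZMod 2) _ v)
  have hE : ∀ y, L (E y) = L' y := fun y => by
    have : E y = v + e y := rfl
    rw [this, hlin, map_add, hv, ← he, hlin' y]
    abel
  have hmem : twist E.toAffineMap (fun y => h (E y) * h' y) ∈ affineMaps k' k' :=
    mem_affineMaps_iff.2 ⟨_, E.surjective, _, (hh.comp_affineMap E.toAffineMap).mul hh', rfl⟩
  refine ⟨⟨Equiv.ofBijective _ (Finite.injective_iff_bijective.1
    (injective_of_mem_affineMaps hmem)), hmem⟩, fun f => ?_⟩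
  funext y
  change f (L (E y)) * h (E y) * (h (E y) * h' y) = f (L' y) * h' y
  rw [hE, mul_assoc, ← mul_assoc (h (E y)), mul_self_apply, one_mul]

open Classical in
/-- A uniformly random affine map is a fixed one followed by a uniformly random affine
permutation. -/
lemma expect_affineMaps {J : BoolFun k → BoolFun k'} (hJ : J ∈ affineMaps k k')
    (F : (BoolFun k → BoolFun k') → ℝ) :
    𝔼 M ∈ affineMaps k k', F M = 𝔼 T : affinePerms k', F (T.1 ∘ J) := by
  refine expect_eq_expect_smul (Γ := affinePerms k') (fun T M hM =>
      show ⇑T.1 ∘ M ∈ affineMaps k k' from comp_mem_affineMaps T.2 hM)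
    (fun M hM N hN => ?_) hJ F
  obtain ⟨T, hT⟩ := exists_affinePerms_comp_eq hM hN
  exact ⟨T, funext hT⟩

/-! ### Pulling back placements -/

/-- The pullback of a placement `g` along an affine map `M`: the affine function `χ_α` gets the sign
that `g` gives to its image `M χ_α`. -/
def pull (M : BoolFun k → BoolFun k') (g : BoolFun k') : BoolFun k := fun α => sgn g (M (chi α))

lemma sgn_pull {M : BoolFun k → BoolFun k'} (hM : M ∈ affineMaps k k') (g : BoolFun k')
    {a : BoolFun k} (ha : a.IsAffine) : sgn (pull M g) a = sgn g (M a) := by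
  obtain ⟨s, α, rfl⟩ := ha.exists_eq
  rw [map_smul_of_mem_affineMaps hM, sgn_smul, sgn_smul, sgn_chi, pull]

lemma pull_comp {k'' : ℕ} {N : BoolFun k' → BoolFun k''} {M : BoolFun k → BoolFun k'}
    (hN : N ∈ affineMaps k' k'') (hM : M ∈ affineMaps k k') (g : BoolFun k'') :
    pull (N ∘ M) g = pull M (pull N g) := by
  funext α
  exact (sgn_pull hN g (isAffine_of_mem_affineMaps hM (isAffine_chi α))).symm

lemma pull_bijective (T : affinePerms k) :
    Function.Bijective (pull (T.1 : BoolFun k → BoolFun k)) := by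
  rw [← Finite.injective_iff_bijective]
  refine Function.LeftInverse.injective (g := pull ((T⁻¹).1 : BoolFun k → BoolFun k)) fun g => ?_
  rw [← pull_comp T.2 (T⁻¹).2]
  funext α
  simp [pull]

/-- A uniformly random placement stays uniformly random under an affine permutation. -/
lemma expect_pull_affinePerms (T : affinePerms k) (F : BoolFun k → ℝ) :
    𝔼 g, F (pull (T.1 : BoolFun k → BoolFun k) g) = 𝔼 g, F g :=
  Fintype.expect_bijective _ (pull_bijective T) _ _ fun _ => rfl

end BoolFun

/-! ### Random sign functions seen through several embeddings -/

/-- Let `φ` average to zero under multiplication by the sign functions in `U`, all of them `1` on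
`S`. If a random sign function `g` on `Y` is seen through an injection `e₁` and through a map `e₂`
whose range meets that of `e₁` only in the image of `S`, then what `φ` sees is uncorrelated with
what is seen through `e₂`: the signs at `e₁ α`, `α ∉ S`, can be resampled without affecting the
latter. -/
lemma sum_mul_comp_eq_zero {X X' Y : Type*} [Fintype Y] [DecidableEq Y] {S : Set X}
    {U : Finset (X → ℤˣ)} (hU : U.Nonempty) (hUS : ∀ u ∈ U, ∀ α ∈ S, u α = 1)
    {φ : (X → ℤˣ) → ℝ} (hφ : ∀ g : X → ℤˣ, ∑ u ∈ U, φ (g * u) = 0)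
    {e₁ : X → Y} (he₁ : Function.Injective e₁) {e₂ : X' → Y}
    (he : ∀ α β, e₁ α = e₂ β → α ∈ S) (ψ : (X' → ℤˣ) → ℝ) :
    ∑ g : Y → ℤˣ, φ (g ∘ e₁) * ψ (g ∘ e₂) = 0 := by
  have hmove : ∀ u ∈ U, ∑ g : Y → ℤˣ, φ (g ∘ e₁) * ψ (g ∘ e₂) =
      ∑ g : Y → ℤˣ, φ ((g ∘ e₁) * u) * ψ (g ∘ e₂) := fun u hu => by
    refine (Fintype.sum_equiv (Equiv.mulRight (Function.extend e₁ u 1)) _ _ fun g => ?_).symm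
    have h1 : (g * Function.extend e₁ u 1) ∘ e₁ = (g ∘ e₁) * u := by
      funext α
      simp [he₁.extend_apply]
    have h2 : (g * Function.extend e₁ u 1) ∘ e₂ = g ∘ e₂ := by
      funext β
      by_cases hβ : ∃ α, e₁ α = e₂ β
      · obtain ⟨α, hα⟩ := hβ
        simp [← hα, he₁.extend_apply, hUS u hu α (he α β hα)]
      · simp [Function.extend_apply' _ _ _ hβ]
    simp only [Equiv.coe_mulRight, h1, h2]
  have hcard : (U.card : ℝ) * ∑ g : Y → ℤˣ, φ (g ∘ e₁) * ψ (g ∘ e₂) = 0 := by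
    rw [← nsmul_eq_mul, ← Finset.sum_const, Finset.sum_congr rfl hmove, Finset.sum_comm]
    refine Finset.sum_eq_zero fun g _ => ?_
    rw [← Finset.sum_mul, hφ, zero_mul]
  exact (mul_eq_zero.1 hcard).resolve_left (by exact_mod_cast hU.card_pos.ne')

/-- A uniformly random sign function is uniformly random when seen through an injection. -/
lemma expect_comp_injective {X Y : Type*} [Fintype X] [Fintype Y] [DecidableEq X] [DecidableEq Y]
    {e : X → Y} (he : Function.Injective e) (φ : (X → ℤˣ) → ℝ) :
    𝔼 g : Y → ℤˣ, φ (g ∘ e) = 𝔼 g : X → ℤˣ, φ g := by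
  have h := sum_mul_comp_eq_zero (S := (∅ : Set X)) Finset.univ_nonempty (by simp)
    (φ := fun g => φ g - 𝔼 g', φ g')
    (fun g => by
      rw [Finset.sum_sub_distrib, Finset.sum_const, Finset.card_univ, Fintype.card_smul_expect,
        sub_eq_zero]
      exact Fintype.sum_equiv (Equiv.mulLeft g) _ _ fun _ => rfl)
    he (e₂ := (fun x : Empty => x.elim)) (fun _ β => β.elim) (fun _ => 1)
  simp only [mul_one, Finset.sum_sub_distrib, Finset.sum_const, Finset.card_univ,
    nsmul_eq_mul] at h
  rw [Fintype.expect_eq_sum_div_card, div_eq_iff (by positivity), mul_comm]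
  exact sub_eq_zero.1 h

/-- The average of `m` bounded, pairwise uncorrelated functions has mean absolute value
`O(1 / √m)`. -/
lemma expect_abs_expect_le {Ω : Type*} [Fintype Ω] [Nonempty Ω] {m : ℕ} (hm : 0 < m)
    (x : Fin m → Ω → ℝ) {B : ℝ} (hB : 0 ≤ B) (hx : ∀ i ω, |x i ω| ≤ B)
    (hcorr : ∀ i j, i ≠ j → ∑ ω, x i ω * x j ω = 0) :
    𝔼 ω, |𝔼 i, x i ω| ≤ B / √m := by
  have hm' : (0 : ℝ) < m := by exact_mod_cast hm
  have hpt : ∀ ω, |𝔼 i, x i ω| ^ 2 = (𝔼 i, 𝔼 j, x i ω * x j ω) := fun ω => by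
    rw [sq_abs, sq, Finset.expect_mul_expect]
  have hcs : (𝔼 ω, |𝔼 i, x i ω|) ^ 2 ≤ 𝔼 ω, |𝔼 i, x i ω| ^ 2 := by
    simpa using Finset.expect_mul_sq_le_sq_mul_sq Finset.univ (fun ω => |𝔼 i, x i ω|) (fun _ => 1)
  have hsq : 𝔼 ω, |𝔼 i, x i ω| ^ 2 ≤ B ^ 2 / m := by
    simp_rw [hpt]
    rw [Finset.expect_comm]
    have hrow : ∀ i, 𝔼 ω, 𝔼 j, x i ω * x j ω ≤ B ^ 2 / m := fun i => by
      rw [Finset.expect_comm, Fintype.expect_eq_sum_div_card, Fintype.card_fin]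
      gcongr
      rw [Finset.sum_eq_single i]
      · refine Finset.expect_le Finset.univ_nonempty fun ω _ => ?_
        rw [← sq, ← sq_abs]
        exact pow_le_pow_left₀ (abs_nonneg _) (hx i ω) 2
      · intro j _ hj
        rw [Fintype.expect_eq_sum_div_card, hcorr i j hj.symm, zero_div]
      · simp
    have : Nonempty (Fin m) := ⟨⟨0, hm⟩⟩
    exact Finset.expect_le Finset.univ_nonempty fun i _ => hrow i
  refine le_of_sq_le_sq (h := ?_) (by positivity)
  rw [div_pow, Real.sq_sqrt hm'.le]
  exact hcs.trans hsq

namespace BoolFun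

open HadGadget

variable {k k' : ℕ}

/-! ### Affine maps with almost disjoint dual images -/

/-- A space of large dimension has many jointly independent linear maps onto `𝔽₂^k`. -/
lemma exists_blocks (k m : ℕ) : ∃ k', k < k' ∧
    ∃ π : Option (Fin m) → BoolVec k' →ₗ[ZMod 2] BoolVec k,
      ∀ z : Option (Fin m) → BoolVec k, ∃ y, ∀ i, π i y = z i := by
  let N := Fintype.card (Option (Fin m) × Fin k)
  let e : Option (Fin m) × Fin k ↪ Fin (N + k + 1) :=
    (Fintype.equivFin _).toEmbedding.trans (Fin.castLEEmb (by omega))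
  refine ⟨N + k + 1, by omega, fun i => LinearMap.funLeft _ _ fun j => e (i, j), fun z => ?_⟩
  refine ⟨Function.extend e (fun p => z p.1 p.2) 0, fun i => ?_⟩
  funext j
  simp [LinearMap.funLeft_apply, e.injective.extend_apply]

/-- A linear endomorphism whose transpose has a prescribed kernel. -/
lemma exists_endomorphism_orthogonal (D : Submodule (ZMod 2) (BoolVec k)) :
    ∃ Q : BoolVec k →ₗ[ZMod 2] BoolVec k, ∀ δ, δ ∈ D ↔ ∀ x, δ ⬝ᵥ Q x = 0 := by
  obtain ⟨C, hC⟩ := D.exists_isCompl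
  let R : BoolVec k →ₗ[ZMod 2] BoolVec k := C.subtype ∘ₗ C.projectionOnto D hC.symm
  have hR : ∀ δ, R δ = 0 ↔ δ ∈ D := fun δ => by
    simp [R]
  refine ⟨(LinearMap.toMatrix' R).transpose.mulVecLin, fun δ => ?_⟩
  have hdot : ∀ x, δ ⬝ᵥ (LinearMap.toMatrix' R).transpose.mulVecLin x = R δ ⬝ᵥ x := fun x => by
    rw [Matrix.mulVecLin_apply, Matrix.dotProduct_mulVec, Matrix.vecMul_transpose,
      LinearMap.toMatrix'_mulVec]
  simp_rw [hdot, ← hR]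
  exact ⟨fun h x => by simp [h], fun h => dotProduct_eq_zero _ h⟩

/-- Affine maps `J i` which all send `f` to the same function, although the images of their duals
meet only in the image of the supporting affine subspace of `f`. With `α₀` in the Fourier support of
`f` and `Q` a linear map with range orthogonal to the direction of that subspace, `J i` replaces the
argument `π₀ y` by `π₀ y + Q (π₀ y + πᵢ y)`; this multiplies `f` by the character
`χ_{α₀} (Q (π₀ y + πᵢ y))`, which `J i` cancels. -/
lemma exists_affineMaps_family (f : BoolFun k) {m : ℕ}
    {π : Option (Fin m) → BoolVec k' →ₗ[ZMod 2] BoolVec k}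
    (hπ : ∀ z : Option (Fin m) → BoolVec k, ∃ y, ∀ i, π i y = z i) :
    ∃ (J : Fin m → BoolFun k → BoolFun k') (f₀ : BoolFun k') (e : Fin m → BoolVec k → BoolVec k'),
      (∀ i, J i ∈ affineMaps k k') ∧ (∀ i, J i f = f₀) ∧
      (∀ i g, pull (J i) g = g ∘ e i) ∧ (∀ i, Function.Injective (e i)) ∧
      ∀ i j, i ≠ j → ∀ α β, e i α = e j β → α ∈ f.support := by
  obtain ⟨Q, hQ⟩ := exists_endomorphism_orthogonal f.support.direction
  obtain ⟨α₀, h₀⟩ := exists_fourier_ne_zero f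
  let q : Fin m → BoolVec k' →ₗ[ZMod 2] BoolVec k := fun i => Q ∘ₗ (π none + π (some i))
  let L : Fin m → BoolVec k' →ᵃ[ZMod 2] BoolVec k := fun i => (π none + q i).toAffineMap
  let h : Fin m → BoolFun k' := fun i y => chi α₀ (q i y)
  let J : Fin m → BoolFun k → BoolFun k' := fun i => twist (L i) (h i)
  have hL : ∀ i y, L i y = π none y + q i y := fun i y => rfl
  have hq : ∀ i y, q i y = Q (π none y + π (some i) y) := fun i y => rfl
  have hh : ∀ i, (h i).IsAffine := fun i => (isAffine_chi α₀).comp_affineMap (q i).toAffineMap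
  have hJchi : ∀ i α y, J i (chi α) y = chi α (π none y) * chi (α + α₀) (q i y) := fun i α y => by
    change chi α (L i y) * chi α₀ (q i y) = _
    rw [hL, chi_add, chi_add_left, mul_assoc]
  have hJ0 : ∀ i α, J i (chi α) 0 = 1 := fun i α => by simp [hJchi]
  have hJmem : ∀ i, J i ∈ affineMaps k k' := fun i => by
    refine mem_affineMaps_iff.2 ⟨L i, fun x => ?_, h i, hh i, rfl⟩
    obtain ⟨y, hy⟩ := hπ fun _ => x
    refine ⟨y, ?_⟩
    rw [hL, hq, hy, hy, ← sub_eq_add x x, sub_self, map_zero, add_zero]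
  have hJeq : ∀ i α, J i (chi α) = chi (freq (J i (chi α))) := fun i α => by
    conv_lhs => rw [(isAffine_of_mem_affineMaps (hJmem i) (isAffine_chi α)).eq_smul_chi]
    rw [hJ0, one_smul]
  refine ⟨J, fun y => f (π none y), fun i α => freq (J i (chi α)), hJmem, fun i => ?_,
    fun i g => ?_, fun i α β hαβ => ?_, fun i j hij α β hαβ => ?_⟩
  · funext y
    change f (L i y) * chi α₀ (q i y) = _
    rw [hL, apply_add_of_orthogonal f h₀ (u := q i y) (fun δ hδ => (hQ δ).1 hδ _), mul_assoc,
      mul_self_apply, mul_one]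
  · funext α
    simp [pull, sgn, hJ0]
  · refine chi_injective (injective_of_mem_affineMaps (hJmem i) ?_)
    rw [hJeq i α, hJeq i β]
    exact congrArg chi hαβ
  · have hfun : J i (chi α) = J j (chi β) := by
      rw [hJeq i α, hJeq j β]
      exact congrArg chi hαβ
    have hδ : α + α₀ ∈ f.support.direction := by
      refine (hQ _).2 fun x => ?_
      -- Evaluate both sides at a point whose only nonzero block is the one of `i`.
      obtain ⟨y, hy⟩ := hπ fun t => if t = some i then x else 0
      have := congrFun hfun y
      rw [hJchi, hJchi, hq, hq] at this
      simpa [hy, hij.symm, chi_eq_one_iff] using this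
    have := AffineSubspace.vadd_mem_of_mem_direction hδ
      (subset_affineSpan (ZMod 2) {α : BoolVec k | f.fourier α ≠ 0} h₀)
    rwa [vadd_eq_add, add_assoc, ← sub_eq_add α₀ α₀, sub_self, add_zero] at this

end BoolFun

namespace HadGadget

open BoolFun

variable {k k' : ℕ}

/-! ### The full lift as a gadget -/

lemma affineMaps_nonempty (h : k ≤ k') : (affineMaps k k').Nonempty := by
  let L : BoolVec k' →ₗ[ZMod 2] BoolVec k := LinearMap.funLeft _ _ (Fin.castLE h)
  have hL : Function.Surjective L :=
    LinearMap.funLeft_surjective_of_injective _ _ _ (Fin.castLE_injective h)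
  exact ⟨_, mem_affineMaps_iff.2 ⟨L.toAffineMap, hL, chi 0, isAffine_chi 0, rfl⟩⟩

lemma sum_liftWeight_mul (M : BoolFun k → BoolFun k') (G : HadGadget k)
    (φ : BoolFun k' → BoolFun k' → ℝ) :
    ∑ f₁', ∑ f₂', liftWeight M G f₁' f₂' * φ f₁' f₂' =
      ∑ f₁, ∑ f₂, G.weight f₁ f₂ * φ (M f₁) (M f₂) := by
  have h : ∀ f₁' f₂', liftWeight M G f₁' f₂' * φ f₁' f₂' =
      ∑ f₁ with M f₁ = f₁', ∑ f₂ with M f₂ = f₂', G.weight f₁ f₂ * φ (M f₁) (M f₂) :=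
    fun f₁' f₂' => by
      rw [liftWeight, Finset.sum_mul]
      refine Finset.sum_congr rfl fun f₁ h₁ => ?_
      rw [Finset.sum_mul]
      refine Finset.sum_congr rfl fun f₂ h₂ => ?_
      rw [(Finset.mem_filter.1 h₁).2, (Finset.mem_filter.1 h₂).2]
  simp_rw [h]
  rw [← Finset.sum_fiberwise Finset.univ M fun f₁ => ∑ f₂, G.weight f₁ f₂ * φ (M f₁) (M f₂)]
  refine Finset.sum_congr rfl fun f₁' _ => ?_
  rw [Finset.sum_comm]
  refine Finset.sum_congr rfl fun f₁ _ => ?_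
  rw [Finset.sum_fiberwise]

lemma sum_fullLiftWeight_mul (G : HadGadget k) (φ : BoolFun k' → BoolFun k' → ℝ) :
    ∑ f₁', ∑ f₂', fullLiftWeight k' G f₁' f₂' * φ f₁' f₂' =
      𝔼 M ∈ affineMaps k k', ∑ f₁, ∑ f₂, G.weight f₁ f₂ * φ (M f₁) (M f₂) := by
  simp_rw [← sum_liftWeight_mul, fullLiftWeight, Finset.expect_mul, Finset.expect_sum_comm]

/-- The full lift of a gadget. -/
def fullLift (G : HadGadget k) (h : k ≤ k') : HadGadget k' where
  weight := fullLiftWeight k' G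
  nonneg f₁ f₂ := Finset.expect_nonneg fun M _ =>
    Finset.sum_nonneg fun f₁ _ => Finset.sum_nonneg fun f₂ _ => G.nonneg f₁ f₂
  symm f₁ f₂ := by
    refine Finset.expect_congr rfl fun M _ => ?_
    rw [liftWeight, liftWeight, Finset.sum_comm]
    exact Finset.sum_congr rfl fun _ _ => Finset.sum_congr rfl fun _ _ => G.symm _ _
  diag f := by
    refine Finset.expect_eq_zero fun M hM => ?_
    refine Finset.sum_eq_zero fun f₁ h₁ => Finset.sum_eq_zero fun f₂ h₂ => ?_
    have : f₁ = f₂ := injective_of_mem_affineMaps hM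
      ((Finset.mem_filter.1 h₁).2.trans (Finset.mem_filter.1 h₂).2.symm)
    rw [this, G.diag]
  antipodal f := by
    refine Finset.expect_eq_zero fun M hM => ?_
    refine Finset.sum_eq_zero fun f₁ h₁ => Finset.sum_eq_zero fun f₂ h₂ => ?_
    have hneg : ∀ {n : ℕ} (a : BoolFun n), (-1 : ℤˣ) • a = -a := fun a => by
      funext x
      simp
    have : f₂ = -f₁ := by
      refine injective_of_mem_affineMaps hM ?_
      rw [(Finset.mem_filter.1 h₂).2, ← hneg f₁, map_smul_of_mem_affineMaps hM,
        (Finset.mem_filter.1 h₁).2, hneg]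
    rw [this, G.antipodal]
  total := by
    have := sum_fullLiftWeight_mul (k' := k') G fun _ _ => 1
    simp only [mul_one] at this
    rw [this, Finset.expect_const (affineMaps_nonempty h), G.total]

lemma val_fullLift (G : HadGadget k) (h : k ≤ k') (A : BoolFun k' → ZMod 2) :
    val A (G.fullLift h) = 𝔼 M ∈ affineMaps k k', val (A ∘ M) G := by
  simp only [val]
  rw [← Finset.mul_expect]
  congr 1
  exact sum_fullLiftWeight_mul G fun f₁ f₂ => if A f₁ = A f₂ then 1 else 0

lemma dictator_eq_dictator_iff (y : BoolVec k) (f₁ f₂ : BoolFun k) :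
    dictator y f₁ = dictator y f₂ ↔ f₁ y = f₂ y := by
  rcases Int.units_eq_one_or (f₁ y) with h₁ | h₁ <;>
    rcases Int.units_eq_one_or (f₂ y) with h₂ | h₂ <;> simp [dictator, h₁, h₂]

/-- A uniformly random point is mapped to a uniformly random point by a surjective affine map. -/
lemma expect_comp_affineMap {L : BoolVec k' →ᵃ[ZMod 2] BoolVec k} (hL : Function.Surjective L)
    (φ : BoolVec k → ℝ) : 𝔼 y, φ (L y) = 𝔼 x, φ x := by
  have h : ∀ x, 𝔼 y, φ (L y) = 𝔼 y, φ (x + L y) := fun x => by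
    obtain ⟨v, rfl⟩ := L.linear_surjective_iff.2 hL x
    refine (Fintype.expect_equiv (Equiv.addLeft v) _ _ fun y => ?_).symm
    exact congrArg φ (L.map_vadd y v).symm
  calc 𝔼 y, φ (L y) = 𝔼 x : BoolVec k, 𝔼 y, φ (x + L y) := by
        rw [← Finset.expect_congr rfl fun x _ => h x, Fintype.expect_const]
    _ = 𝔼 y, 𝔼 x : BoolVec k, φ (x + L y) := Finset.expect_comm _ _ _
    _ = 𝔼 _y : BoolVec k', 𝔼 x, φ x := Finset.expect_congr rfl fun y _ =>
        Fintype.expect_equiv (Equiv.addRight (L y)) _ _ fun x => rfl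
    _ = _ := Fintype.expect_const _

lemma completeness_fullLift (G : HadGadget k) (h : k ≤ k') :
    (G.fullLift h).completeness = G.completeness := by
  simp only [completeness, val_fullLift]
  rw [Finset.expect_comm]
  rw [← Finset.expect_const (affineMaps_nonempty h) (𝔼 y : BoolVec k, val (dictator y) G)]
  refine Finset.expect_congr rfl fun M hM => ?_
  obtain ⟨L, hL, a, -, rfl⟩ := mem_affineMaps_iff.1 hM
  rw [← expect_comp_affineMap hL]
  refine Finset.expect_congr rfl fun y _ => ?_
  simp [val, dictator_eq_dictator_iff, twist]

/-! ### Cuts bound flows -/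

/-- The net flow out of `f` under the placement `g`. -/
def netFlow (w : BoolFun k → BoolFun k → BoolFun k → ℝ) (f g : BoolFun k) : ℝ :=
  outflow w f g - inflow w f g

/-- The easy half of max-flow min-cut: the net flow out of `{f | A f = 0}` is at most the weight of
the pairs cut by `A`. -/
lemma sum_netFlow_le_one_sub_val {G : HadGadget k} {w : BoolFun k → BoolFun k → BoolFun k → ℝ}
    (hw : IsInfRelaxedFlow G w) (A : BoolFun k → ZMod 2) (g : BoolFun k) :
    ∑ f, (if A f = 0 then netFlow w f g else 0) ≤ 1 - val A G := by
  let σ : BoolFun k → ℝ := fun f => if A f = 0 then 1 else 0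
  have h1 : ∑ f, (if A f = 0 then netFlow w f g else 0) =
      ∑ f₁, ∑ f₂, σ f₁ * w f₁ f₂ g - ∑ f₁, ∑ f₂, σ f₁ * w f₂ f₁ g := by
    rw [← Finset.sum_sub_distrib]
    refine Finset.sum_congr rfl fun f _ => ?_
    rw [← Finset.mul_sum, ← Finset.mul_sum, ← mul_sub]
    simp only [σ, netFlow, outflow, inflow]
    split_ifs <;> simp
  have h2 : ∑ f₁, ∑ f₂, σ f₁ * w f₂ f₁ g = ∑ f₁, ∑ f₂, σ f₂ * w f₁ f₂ g := Finset.sum_comm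
  have h3 : ∑ f₁, ∑ f₂, σ f₁ * w f₁ f₂ g = ∑ f₁, ∑ f₂, σ f₂ * w f₂ f₁ g := Finset.sum_comm
  have h4 : 2 * ∑ f, (if A f = 0 then netFlow w f g else 0) =
      ∑ f₁, ∑ f₂, (σ f₁ - σ f₂) * (w f₁ f₂ g - w f₂ f₁ g) := by
    have : ∑ f₁, ∑ f₂, (σ f₁ - σ f₂) * (w f₁ f₂ g - w f₂ f₁ g) =
        ∑ f₁, ∑ f₂, σ f₁ * w f₁ f₂ g - ∑ f₁, ∑ f₂, σ f₁ * w f₂ f₁ g -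
          ∑ f₁, ∑ f₂, σ f₂ * w f₁ f₂ g + ∑ f₁, ∑ f₂, σ f₂ * w f₂ f₁ g := by
      simp only [← Finset.sum_sub_distrib, ← Finset.sum_add_distrib]
      exact Finset.sum_congr rfl fun _ _ => Finset.sum_congr rfl fun _ _ => by ring
    rw [this, h1, ← h2, ← h3]
    ring
  have h5 : 2 * (1 - val A G) =
      ∑ f₁, ∑ f₂, G.weight f₁ f₂ * (1 - if A f₁ = A f₂ then 1 else 0) := by
    have ht := G.total
    simp only [mul_sub, mul_one, Finset.sum_sub_distrib, val]
    linarith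
  have h6 : ∑ f₁, ∑ f₂, (σ f₁ - σ f₂) * (w f₁ f₂ g - w f₂ f₁ g) ≤
      ∑ f₁, ∑ f₂, G.weight f₁ f₂ * (1 - if A f₁ = A f₂ then 1 else 0) := by
    refine Finset.sum_le_sum fun f₁ _ => Finset.sum_le_sum fun f₂ _ => ?_
    have hc := hw.capacity f₁ f₂ g
    have hn1 := hw.nonneg f₁ f₂ g
    have hn2 := hw.nonneg f₂ f₁ g
    by_cases hA : A f₁ = A f₂
    · simp [σ, hA]
    · simp only [σ, hA, if_false, sub_zero, mul_one]
      split_ifs <;> linarith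
  linarith

/-- The part of the net flow out of `{f | A (M f) = 0}` at affine functions is the value of the
flow, if `A` is the assignment of the affine functions given by the placement `g`. -/
lemma sum_netFlow_isAffine (w : BoolFun k → BoolFun k → BoolFun k → ℝ)
    [DecidablePred (IsAffine : BoolFun k → Prop)]
    {M : BoolFun k → BoolFun k'} (hM : M ∈ affineMaps k k') (g : BoolFun k')
    {A : BoolFun k' → ZMod 2} (hA : ∀ a : BoolFun k', a.IsAffine → (A a = 0 ↔ sgn g a = 1)) :
    ∑ f with IsAffine f, (if A (M f) = 0 then netFlow w f (pull M g) else 0) =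
      flowVal w (pull M g) := by
  have hsgn : ∀ f : BoolFun k, f.IsAffine → (A (M f) = 0 ↔ sgn (pull M g) f = 1) := fun f hf => by
    rw [sgn_pull hM g hf, hA _ (isAffine_of_mem_affineMaps hM hf)]
  rw [← Finset.sum_filter, Finset.filter_filter]
  symm
  refine Finset.sum_bij (fun α _ => pull M g α • chi α) (fun α _ => ?_) (fun α _ β _ h => ?_)
    (fun f hf => ?_) (fun α _ => rfl)
  · have ha := isAffine_smul_chi (pull M g α) α
    simp only [Finset.mem_filter, Finset.mem_univ, true_and]
    exact ⟨ha, (hsgn _ ha).2 (by simp)⟩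
  · simpa using congrArg freq h
  · obtain ⟨-, hf, hf0⟩ := Finset.mem_filter.1 hf
    have h1 := (hsgn f hf).1 hf0
    refine ⟨freq f, Finset.mem_univ _, ?_⟩
    conv_rhs => rw [hf.eq_smul_chi]
    congr 1
    rw [sgn] at h1
    rw [← one_mul (pull M g (freq f)), ← mul_self_apply f 0, mul_assoc, h1, mul_one]

/-! ### Lifting a flow -/

/-- The total amount by which the lift of the flow `w` fails to be conserved at the images of `f`
under affine maps, for the placement `g`. -/
def imbalance (w : BoolFun k → BoolFun k → BoolFun k → ℝ) (f : BoolFun k) (g : BoolFun k') : ℝ :=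
  ∑ f', |𝔼 M ∈ affineMaps k k', if M f = f' then netFlow w f (pull M g) else 0|

open Classical in
lemma flowVal_sub_imbalance_le {G : HadGadget k} {w : BoolFun k → BoolFun k → BoolFun k → ℝ}
    (hw : IsInfRelaxedFlow G w) (h : k ≤ k') (g : BoolFun k') {A : BoolFun k' → ZMod 2}
    (hA : ∀ a : BoolFun k', a.IsAffine → (A a = 0 ↔ sgn g a = 1)) :
    𝔼 M ∈ affineMaps k k', flowVal w (pull M g) - ∑ f with ¬ IsAffine f, imbalance w f g ≤
      1 - val A (G.fullLift h) := by
  have h1 : 𝔼 M ∈ affineMaps k k', ∑ f, (if A (M f) = 0 then netFlow w f (pull M g) else 0) ≤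
      1 - val A (G.fullLift h) := by
    have : 1 - val A (G.fullLift h) = 𝔼 M ∈ affineMaps k k', (1 - val (A ∘ M) G) := by
      rw [val_fullLift, Finset.expect_sub_distrib, Finset.expect_const (affineMaps_nonempty h)]
    rw [this]
    exact Finset.expect_le_expect fun M _ => sum_netFlow_le_one_sub_val hw (A ∘ M) (pull M g)
  have h2 : 𝔼 M ∈ affineMaps k k', ∑ f, (if A (M f) = 0 then netFlow w f (pull M g) else 0) =
      𝔼 M ∈ affineMaps k k', flowVal w (pull M g) +
        ∑ f with ¬ IsAffine f,
          𝔼 M ∈ affineMaps k k', (if A (M f) = 0 then netFlow w f (pull M g) else 0) := by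
    rw [← Finset.expect_sum_comm, ← Finset.expect_add_distrib]
    refine Finset.expect_congr rfl fun M hM => ?_
    rw [← sum_netFlow_isAffine w hM g hA, Finset.sum_filter_add_sum_filter_not]
  have h3 : ∀ f, -imbalance w f g ≤
      𝔼 M ∈ affineMaps k k', (if A (M f) = 0 then netFlow w f (pull M g) else 0) := fun f => by
    have : 𝔼 M ∈ affineMaps k k', (if A (M f) = 0 then netFlow w f (pull M g) else 0) =
        ∑ f', if A f' = 0 then
          𝔼 M ∈ affineMaps k k', (if M f = f' then netFlow w f (pull M g) else 0) else 0 := by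
      have hM : ∀ M : BoolFun k → BoolFun k',
          (if A (M f) = 0 then netFlow w f (pull M g) else 0) =
            ∑ f', if A f' = 0 then (if M f = f' then netFlow w f (pull M g) else 0) else 0 :=
        fun M => by
          rw [Finset.sum_eq_single (M f)]
          · simp
          · intro f' _ hf'
            simp [hf'.symm]
          · simp
      simp_rw [hM]
      rw [Finset.expect_sum_comm]
      refine Finset.sum_congr rfl fun f' _ => ?_
      split_ifs <;> simp
    rw [this, imbalance, ← Finset.sum_neg_distrib]
    refine Finset.sum_le_sum fun f' _ => ?_
    split_ifs
    · exact neg_abs_le _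
    · exact neg_nonpos.2 (abs_nonneg _)
  have h4 := Finset.sum_le_sum fun f (_ : f ∈ Finset.univ.filter fun f : BoolFun k => ¬ IsAffine f)
    => h3 f
  rw [Finset.sum_neg_distrib] at h4
  linarith

/-- Conservation of flow as a cancellation over the sign changes away from the supporting affine
subspace. -/
lemma IsInfRelaxedFlow.sum_netFlow_mul {G : HadGadget k}
    {w : BoolFun k → BoolFun k → BoolFun k → ℝ} (hw : IsInfRelaxedFlow G w) {f : BoolFun k}
    (hf : 1 ≤ f.dim) [DecidablePred fun u : BoolFun k => ∀ α ∈ f.support, u α = 1] (g : BoolFun k) :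
    ∑ u : BoolFun k with ∀ α ∈ f.support, u α = 1, netFlow w f (g * u) = 0 := by
  have h := hw.conservation g f hf
  rw [← sub_eq_zero, ← Finset.sum_sub_distrib] at h
  rw [← h]
  refine Finset.sum_nbij' (g * ·) (g⁻¹ * ·) ?_ ?_ ?_ ?_ ?_
  · intro u hu
    simp only [Finset.mem_filter, Finset.mem_univ, true_and] at hu
    simp +contextual [hu]
  · intro g' hg'
    simp only [Finset.mem_filter, Finset.mem_univ, true_and] at hg'
    simp +contextual [hg']
  · simp
  · simp
  · intro u _
    rfl

/-- The lift of an infinity relaxed flow is almost conserved for most placements: every affine map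
belongs to an equidistributed family of `m` affine maps which agree at `f` and see uncorrelated
placements away from the supporting affine subspace of `f`. -/
lemma expect_imbalance_le {G : HadGadget k} {w : BoolFun k → BoolFun k → BoolFun k → ℝ}
    (hw : IsInfRelaxedFlow G w) {f : BoolFun k} (hf : 1 ≤ f.dim) {B : ℝ} (hB : 0 ≤ B)
    (hwB : ∀ g, |netFlow w f g| ≤ B) {m : ℕ} (hm : 0 < m)
    {π : Option (Fin m) → BoolVec k' →ₗ[ZMod 2] BoolVec k}
    (hπ : ∀ z : Option (Fin m) → BoolVec k, ∃ y, ∀ i, π i y = z i) :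
    𝔼 g : BoolFun k', imbalance w f g ≤ B / √m := by
  classical
  obtain ⟨J, f₀, e, hJ, hJf, hpull, he, hdisj⟩ := exists_affineMaps_family f hπ
  have : Nonempty (Fin m) := ⟨⟨0, hm⟩⟩
  let X : BoolFun k' → ℝ := fun g => 𝔼 i, netFlow w f (g ∘ e i)
  have hX : 𝔼 g, |X g| ≤ B / √m := by
    refine expect_abs_expect_le hm (fun i g => netFlow w f (g ∘ e i)) hB (fun i g => hwB _)
      fun i j hij => ?_
    exact sum_mul_comp_eq_zero (S := (f.support : Set (BoolVec k)))
      (U := Finset.univ.filter fun u : BoolFun k => ∀ α ∈ f.support, u α = 1)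
      ⟨1, by simp⟩ (fun u hu => (Finset.mem_filter.1 hu).2)
      (hw.sum_netFlow_mul hf) (he i) (hdisj i j hij) _
  have hmean : ∀ (g f' : BoolFun k'),
      𝔼 M ∈ affineMaps k k', (if M f = f' then netFlow w f (pull M g) else 0) =
        𝔼 T : affinePerms k', if T.1 f₀ = f' then X (pull T.1 g) else 0 := fun g f' => by
    have hi : ∀ i, 𝔼 M ∈ affineMaps k k', (if M f = f' then netFlow w f (pull M g) else 0) =
        𝔼 T : affinePerms k', if T.1 f₀ = f' then netFlow w f (pull T.1 g ∘ e i) else 0 :=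
      fun i => by
        rw [expect_affineMaps (hJ i)]
        refine Finset.expect_congr rfl fun T _ => ?_
        rw [pull_comp T.2 (hJ i), hpull, Function.comp_apply, hJf]
    rw [← Fintype.expect_const (ι := Fin m) (𝔼 M ∈ affineMaps k k', _),
      Finset.expect_congr rfl fun i _ => hi i, Finset.expect_comm]
    refine Finset.expect_congr rfl fun T _ => ?_
    split_ifs <;> simp [X]
  have hbound : ∀ g : BoolFun k', imbalance w f g ≤ 𝔼 T : affinePerms k', |X (pull T.1 g)| :=
    fun g => by
      have h1 : ∀ f', |𝔼 M ∈ affineMaps k k', if M f = f' then netFlow w f (pull M g) else 0| ≤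
          𝔼 T : affinePerms k', if T.1 f₀ = f' then |X (pull T.1 g)| else 0 := fun f' => by
        rw [hmean]
        refine (Finset.abs_expect_le _ _).trans_eq (Finset.expect_congr rfl fun T _ => ?_)
        split_ifs <;> simp
      refine (Finset.sum_le_sum fun f' _ => h1 f').trans_eq ?_
      rw [← Finset.expect_sum_comm]
      simp
  calc 𝔼 g : BoolFun k', imbalance w f g
      ≤ 𝔼 g : BoolFun k', 𝔼 T : affinePerms k', |X (pull T.1 g)| :=
        Finset.expect_le_expect fun g _ => hbound g
    _ = 𝔼 T : affinePerms k', 𝔼 g : BoolFun k', |X (pull T.1 g)| := Finset.expect_comm _ _ _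
    _ = 𝔼 T : affinePerms k', 𝔼 g, |X g| :=
        Finset.expect_congr rfl fun T _ => expect_pull_affinePerms T fun g => |X g|
    _ = 𝔼 g, |X g| := Fintype.expect_const _
    _ ≤ B / √m := hX

/-- The pullback of a uniformly random placement is uniformly random. -/
lemma expect_expect_pull {m : ℕ} (hm : 0 < m)
    {π : Option (Fin m) → BoolVec k' →ₗ[ZMod 2] BoolVec k}
    (hπ : ∀ z : Option (Fin m) → BoolVec k, ∃ y, ∀ i, π i y = z i) (φ : BoolFun k → ℝ) :
    𝔼 g : BoolFun k', 𝔼 M ∈ affineMaps k k', φ (pull M g) = 𝔼 g, φ g := by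
  classical
  obtain ⟨J, f₀, e, hJ, -, hpull, he, -⟩ := exists_affineMaps_family (1 : BoolFun k) hπ
  let i : Fin m := ⟨0, hm⟩
  have h1 : ∀ g : BoolFun k', 𝔼 M ∈ affineMaps k k', φ (pull M g) =
      𝔼 T : affinePerms k', φ (pull T.1 g ∘ e i) := fun g => by
    rw [expect_affineMaps (hJ i)]
    refine Finset.expect_congr rfl fun T _ => ?_
    rw [pull_comp T.2 (hJ i), hpull]
  calc _ = 𝔼 g : BoolFun k', 𝔼 T : affinePerms k', φ (pull T.1 g ∘ e i) :=
        Finset.expect_congr rfl fun g _ => h1 g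
    _ = 𝔼 T : affinePerms k', 𝔼 g : BoolFun k', φ (pull T.1 g ∘ e i) := Finset.expect_comm _ _ _
    _ = 𝔼 T : affinePerms k', 𝔼 g : BoolFun k', φ (g ∘ e i) :=
        Finset.expect_congr rfl fun T _ => expect_pull_affinePerms T fun g => φ (g ∘ e i)
    _ = 𝔼 g : BoolFun k', φ (g ∘ e i) := Fintype.expect_const _
    _ = _ := expect_comp_injective (he i) φ

/-! ### Folded assignments as placements -/

/-- The placement of a folded assignment `P`: the sign `g(α)` for which `P` vanishes at
`g(α) χ_α`. -/
def FoldedPrimary.placement (P : FoldedPrimary k) : BoolFun k :=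
  fun α => (-1 : ℤˣ) ^ P.1 ⟨chi α, isAffine_chi α⟩

lemma FoldedPrimary.eq_zero_iff (P : FoldedPrimary k) {a : BoolFun k} (ha : a.IsAffine) :
    P.1 ⟨a, ha⟩ = 0 ↔ sgn P.placement a = 1 := by
  have hchi : ∀ α, P.1 ⟨chi α, isAffine_chi α⟩ = 0 ↔ P.placement α = 1 := fun α =>
    (neg_one_uzpow_eq_one_iff _).symm
  obtain ⟨α, rfl | rfl⟩ := ha
  · rw [sgn_chi, hchi]
  · have hsgn : sgn P.placement (-chi α) = -P.placement α := by
      have : -chi α = (-1 : ℤˣ) • chi α := by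
        funext x
        simp
      rw [this, sgn_smul, sgn_chi, neg_one_mul]
    rw [hsgn, P.2 ⟨chi α, isAffine_chi α⟩, neg_eq_iff_eq_neg, ← Int.units_ne_iff_eq_neg,
      ne_eq, ← hchi]
    obtain h | h := eq_zero_or_eq_one (P.1 ⟨chi α, isAffine_chi α⟩) <;> rw [h] <;> decide

lemma FoldedPrimary.placement_bijective :
    Function.Bijective (FoldedPrimary.placement : FoldedPrimary k → BoolFun k) := by
  have hz : ∀ z z' : ZMod 2, (z = 0 ↔ z' = 0) → z = z' := by decide
  constructor
  · intro P P' h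
    refine Subtype.ext (funext fun a => hz _ _ ?_)
    rw [P.eq_zero_iff a.2, P'.eq_zero_iff a.2, h]
  · intro g
    refine ⟨⟨fun a => if sgn g a.1 = 1 then 0 else 1, fun a => ?_⟩, funext fun α => ?_⟩
    · have : sgn g (-a.1) = -sgn g a.1 := by
        have : -a.1 = (-1 : ℤˣ) • a.1 := by
          funext x
          simp
        rw [this, sgn_smul, neg_one_mul]
      simp only [this]
      rcases Int.units_eq_one_or (sgn g a.1) with h | h <;> rw [h] <;> decide
    · simp only [placement, sgn_chi]
      rcases Int.units_eq_one_or (g α) with h | h <;> simp [h, uzpow_one]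

open Classical in
/-- The soundness of the lift is bounded through any infinity relaxed flow. -/
lemma relaxedSoundness_fullLift_le {G : HadGadget k} {w : BoolFun k → BoolFun k → BoolFun k → ℝ}
    (hw : IsInfRelaxedFlow G w) (h : k ≤ k') :
    (G.fullLift h).relaxedSoundness ≤
      1 - 𝔼 g : BoolFun k', 𝔼 M ∈ affineMaps k k', flowVal w (pull M g) +
        ∑ f with ¬ IsAffine f, 𝔼 g : BoolFun k', imbalance w f g := by
  let F : BoolFun k' → ℝ := fun g =>
    1 - 𝔼 M ∈ affineMaps k k', flowVal w (pull M g) + ∑ f with ¬ IsAffine f, imbalance w f g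
  have hP : ∀ P : FoldedPrimary k', (⨆ A : {A : BoolFun k' → ZMod 2 //
      ∀ f : {f : BoolFun k' // f.IsAffine}, A f.1 = P.1 f}, val A.1 (G.fullLift h)) ≤
        F P.placement := fun P => by
    have : Nonempty {A : BoolFun k' → ZMod 2 //
        ∀ f : {f : BoolFun k' // f.IsAffine}, A f.1 = P.1 f} :=
      ⟨⟨fun f => if hf : f.IsAffine then P.1 ⟨f, hf⟩ else 0, fun f => by simp [f.2]⟩⟩
    refine ciSup_le fun A => ?_
    have := flowVal_sub_imbalance_le hw h P.placement (A := A.1) fun a ha => by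
      rw [A.2 ⟨a, ha⟩, P.eq_zero_iff]
    simp only [F]
    linarith
  rw [relaxedSoundness]
  calc _ ≤ 𝔼 P : FoldedPrimary k', F P.placement := Finset.expect_le_expect fun P _ => hP P
    _ = 𝔼 g, F g := Fintype.expect_bijective _ FoldedPrimary.placement_bijective _ _ fun _ => rfl
    _ = _ := by
      simp only [F]
      rw [Finset.expect_add_distrib, Finset.expect_sub_distrib, Fintype.expect_const,
        Finset.expect_sum_comm]

lemma isInfRelaxedFlow_zero (G : HadGadget k) : IsInfRelaxedFlow G fun _ _ _ => 0 where
  nonneg _ _ _ := le_rfl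
  capacity f₁ f₂ _ := by simpa using G.nonneg f₁ f₂
  conservation _ _ _ := by simp [outflow, inflow]

/-- The soundness of the lift to a large dimension is at most `1` minus the value of a given
infinity relaxed flow, up to an arbitrarily small error. -/
lemma exists_relaxedSoundness_fullLift_le {G : HadGadget k}
    {w : BoolFun k → BoolFun k → BoolFun k → ℝ} (hw : IsInfRelaxedFlow G w) {δ : ℝ} (hδ : 0 < δ) :
    ∃ k', ∃ h : k < k', (G.fullLift h.le).relaxedSoundness ≤ 1 - 𝔼 g, flowVal w g + δ := by
  classical
  let B : ℝ := ∑ f, ∑ g, |netFlow w f g|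
  have hB : 0 ≤ B := Finset.sum_nonneg fun f _ => Finset.sum_nonneg fun g _ => abs_nonneg _
  have hwB : ∀ f g, |netFlow w f g| ≤ B := fun f g =>
    (Finset.single_le_sum (f := fun g => |netFlow w f g|) (fun g _ => abs_nonneg _)
      (Finset.mem_univ g)).trans
    (Finset.single_le_sum (f := fun f => ∑ g, |netFlow w f g|)
      (fun f _ => Finset.sum_nonneg fun g _ => abs_nonneg _) (Finset.mem_univ f))
  let N : ℝ := ((Finset.univ.filter fun f : BoolFun k => ¬ IsAffine f).card : ℝ)
  obtain ⟨m, hm⟩ := exists_nat_gt ((N * B / δ) ^ 2)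
  have hm0 : 0 < m := by
    have : (0 : ℝ) < m := (sq_nonneg _).trans_lt hm
    exact_mod_cast this
  have hNB : N * (B / √m) ≤ δ := by
    have h1 : N * B / δ ≤ √m := Real.le_sqrt_of_sq_le hm.le
    have h2 : 0 < √(m : ℝ) := Real.sqrt_pos.2 (by exact_mod_cast hm0)
    rw [← mul_div_assoc, div_le_iff₀ h2]
    rwa [div_le_iff₀' hδ] at h1
  obtain ⟨k', hk, π, hπ⟩ := exists_blocks k m
  refine ⟨k', hk, (relaxedSoundness_fullLift_le hw hk.le).trans ?_⟩
  rw [expect_expect_pull hm0 hπ]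
  have : ∑ f with ¬ IsAffine f, 𝔼 g : BoolFun k', imbalance w f g ≤ N * (B / √m) := by
    rw [← nsmul_eq_mul]
    refine Finset.sum_le_card_nsmul _ _ _ fun f hf => ?_
    exact expect_imbalance_le hw (one_le_dim_of_not_isAffine (Finset.mem_filter.1 hf).2) hB (hwB f)
      hm0 hπ
  linarith

end HadGadget

end

theorem mainTheorem4 {k : ℕ} (G : HadGadget k) (ε : ℝ) (hε : 0 < ε) :
    ∃ k' : ℕ, k < k' ∧ ∃ G' : HadGadget k',
      (∀ f₁ f₂ : BoolFun k', G'.weight f₁ f₂ = HadGadget.fullLiftWeight k' G f₁ f₂) ∧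
      G'.completeness = G.completeness ∧
      G'.relaxedSoundness ≤ G.infRelaxedSoundness + ε := by
  obtain ⟨_, ⟨w, hw, rfl⟩, hlt⟩ := exists_lt_of_lt_csSup
    (s := {v : ℝ | ∃ w, G.IsInfRelaxedFlow w ∧ v = 𝔼 g : BoolFun k, HadGadget.flowVal w g})
    ⟨_, _, G.isInfRelaxedFlow_zero, rfl⟩ (sub_lt_self _ (half_pos hε))
  obtain ⟨k', hk, hrs⟩ := HadGadget.exists_relaxedSoundness_fullLift_le hw (half_pos hε)
  refine ⟨k', hk, G.fullLift hk.le, fun _ _ => rfl, G.completeness_fullLift hk.le, ?_⟩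
  rw [HadGadget.infRelaxedSoundness]
  linarith
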